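/- Let $M$ be a compact complex manifold of dimension $n$ with a smooth Kähler form $\omega_0$, let $L\to M$ be a holomorphic line bundle with a smooth Hermitian metric $|\cdot|$, and let $S$ be a holomorphic section of $L$ which vanishes transversally along its zero set $D=\{S=0\}$ (so $D$ is a smooth divisor with defining section $S$). Let $0<\beta<1$, let $h$ be a smooth real function on $M$, and let $\delta>0$ be so small that $\omega_D=\omega_0+\delta\, i\partial\bar\partial |S|^{2\beta}$ is positive definite on $M\setminus D$. For a real function $\phi$ write $\omega_\phi=\omega_0+i\partial\bar\partial\phi$. Let $0<\alpha<1$, $T>0$, let $\phi_0$ be a real function on $M$, and let $\phi_1,\phi_2$ be two weak conical Kähler–Ricci flows on $[0,T]$ with initial value $\phi_0$; that is, for $i=1,2$: 1. $\phi_i(0)=\phi_0$ on $M$, and $\phi_i\in C^{\alpha,\alpha/2}(M\times[0,T])$ (in the usual sense, in smooth local coordinates of $M$); 2. for every $t\in(0,T)$ the function $\phi_i(t)$ is $C^2$ on $M\setminus D$, and on $(M\setminus D)\times(0,T)$ the time derivative exists and $$\frac{\partial\phi_i}{\partial t}=\log\frac{\omega_{\phi_i}^n}{\omega_0^n}+\beta\phi_i+h+(1-\beta)\log|S|^2;$$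 3. there is a constant $C>0$ with $\frac1C\,\omega_D\le\omega_{\phi_i}\le C\,\omega_D$ and $\left|\frac{\partial\phi_i}{\partial t}\right|\le C$ on $(M\setminus D)\times(0,T)$. Then $\phi_1=\phi_2$ on $M\times[0,T]$. -/

import Mathlib

open scoped ContDiff Manifold ComplexOrder

noncomputable section

namespace ConicalKRF

/-- The model space `ℂⁿ` of an `n`-dimensional complex manifold. -/
abbrev CSpace (n : ℕ) : Type := EuclideanSpace ℂ (Fin n)

/-- The Wirtinger derivative `∂f/∂z_k = (∂f/∂x_k - i ∂f/∂y_k)/2`. -/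
def dz {n : ℕ} (k : Fin n) (f : CSpace n → ℂ) (z : CSpace n) : ℂ :=
  (fderiv ℝ f z (EuclideanSpace.single k 1)
    - Complex.I * fderiv ℝ f z (EuclideanSpace.single k Complex.I)) / 2

/-- The Wirtinger derivative `∂f/∂z̄_k = (∂f/∂x_k + i ∂f/∂y_k)/2`. -/
def dzbar {n : ℕ} (k : Fin n) (f : CSpace n → ℂ) (z : CSpace n) : ℂ :=
  (fderiv ℝ f z (EuclideanSpace.single k 1)
    + Complex.I * fderiv ℝ f z (EuclideanSpace.single k Complex.I)) / 2

/-- The complex Hessian `(∂²u/∂z_i∂z̄_j)` of a real function `u`, that is, the coefficient matrix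
of `√-1 ∂∂̄u = √-1 ∑ u_{ij̄} dz_i ∧ dz̄_j`. -/
def complexHessian {n : ℕ} (u : CSpace n → ℝ) (z : CSpace n) : Matrix (Fin n) (Fin n) ℂ :=
  Matrix.of fun i j => dz i (fun w => dzbar j (fun y => (u y : ℂ)) w) z

section Background

variable {n : ℕ} {M : Type*} [TopologicalSpace M] [ChartedSpace (CSpace n) M]

/-- The coefficient matrix `g_{ij̄} = g(∂/∂z_i, ∂/∂z_j)` of a field of sesquilinear forms on the
holomorphic tangent spaces of `M`, in the chart `e`, at the point with coordinates `z`. -/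
def coeff
    (g : (x : M) → TangentSpace 𝓘(ℂ, CSpace n) x →ₗ[ℂ] TangentSpace 𝓘(ℂ, CSpace n) x →ₗ⋆[ℂ] ℂ)
    (e : OpenPartialHomeomorph M (CSpace n)) (z : CSpace n) : Matrix (Fin n) (Fin n) ℂ :=
  Matrix.of fun i j => g (e.symm z)
    (mfderiv 𝓘(ℂ, CSpace n) 𝓘(ℂ, CSpace n) e.symm z (EuclideanSpace.single i (1 : ℂ)))
    (mfderiv 𝓘(ℂ, CSpace n) 𝓘(ℂ, CSpace n) e.symm z (EuclideanSpace.single j (1 : ℂ)))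

variable (n M) in
/-- A (smooth) Kähler form `ω = √-1 ∑ g_{ij̄} dz_i ∧ dz̄_j` on the complex manifold `M`, given by
its Hermitian form `g` on the holomorphic tangent bundle. -/
structure KahlerForm where
  /-- The Hermitian form, linear in the first and conjugate-linear in the second variable. -/
  form : (x : M) →
    TangentSpace 𝓘(ℂ, CSpace n) x →ₗ[ℂ] TangentSpace 𝓘(ℂ, CSpace n) x →ₗ⋆[ℂ] ℂ
  conj_symm : ∀ (x : M) (v w : TangentSpace 𝓘(ℂ, CSpace n) x),
    form x w v = starRingEnd ℂ (form x v w)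
  pos : ∀ (x : M) (v : TangentSpace 𝓘(ℂ, CSpace n) x), v ≠ 0 → 0 < (form x v v).re
  smooth : ∀ e ∈ atlas (CSpace n) M, ∀ i j : Fin n,
    ContDiffOn ℝ ∞ (fun z => coeff form e z i j) e.target
  /-- `dω = 0`, which for a real `(1,1)`-form is `∂g_{ij̄}/∂z_k = ∂g_{kj̄}/∂z_i`. -/
  closed : ∀ e ∈ atlas (CSpace n) M, ∀ z ∈ e.target, ∀ i j k : Fin n,
    dz k (fun w => coeff form e w i j) z = dz i (fun w => coeff form e w k j) z

/-- The coefficient matrix, in the chart `e`, of the `(1,1)`-form `ω₀ + √-1 ∂∂̄u`. -/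
def KahlerForm.potMatrix (ω₀ : KahlerForm n M) (u : M → ℝ)
    (e : OpenPartialHomeomorph M (CSpace n)) (z : CSpace n) : Matrix (Fin n) (Fin n) ℂ :=
  coeff ω₀.form e z + complexHessian (u ∘ e.symm) z

/-- The ratio of volume forms `(ω₀ + √-1 ∂∂̄u)ⁿ / ω₀ⁿ` at the point with coordinates `z` in the
chart `e`. It does not depend on the chart. -/
def KahlerForm.volRatio (ω₀ : KahlerForm n M) (u : M → ℝ)
    (e : OpenPartialHomeomorph M (CSpace n)) (z : CSpace n) : ℝ :=
  ((ω₀.potMatrix u e z).det / (coeff ω₀.form e z).det).re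

/-- The parabolic Hölder space `C^{α,α/2}(M × [0,T])`: in local coordinates, locally uniformly,
`|u(z,t) - u(w,s)| ≤ C (|z - w|^α + |t - s|^{α/2})`. -/
def ParabolicHolder (n : ℕ) {M : Type*} [TopologicalSpace M] [ChartedSpace (CSpace n) M]
    (α T : ℝ) (u : ℝ → M → ℝ) : Prop :=
  ∀ e ∈ atlas (CSpace n) M, ∀ K ⊆ e.target, IsCompact K →
    ∃ C : ℝ, ∀ z ∈ K, ∀ w ∈ K, ∀ t ∈ Set.Icc 0 T, ∀ s ∈ Set.Icc 0 T,
      |u t (e.symm z) - u s (e.symm w)| ≤ C * (‖z - w‖ ^ α + |t - s| ^ (α / 2))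

variable (L : M → Type*) [TopologicalSpace (Bundle.TotalSpace ℂ L)]
  [∀ x, AddCommGroup (L x)] [∀ x, Module ℂ (L x)] [∀ x, TopologicalSpace (L x)]
  [FiberBundle ℂ L] [VectorBundle ℂ ℂ L]

variable (n) in
/-- A smooth Hermitian metric on the line bundle `L`, given by the squared norm on its fibres;
smoothness (in the real sense) is that of the squared norms of the local frames. -/
structure HermitianMetric where
  /-- The squared norm on the fibres. -/
  normSq : (x : M) → L x → ℝ
  pos : ∀ (x : M) (v : L x), v ≠ 0 → 0 < normSq x v
  smul : ∀ (x : M) (c : ℂ) (v : L x), normSq x (c • v) = ‖c‖ ^ 2 * normSq x v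
  smooth : ∀ (τ : Bundle.Trivialization ℂ (Bundle.TotalSpace.proj : Bundle.TotalSpace ℂ L → M))
    [MemTrivializationAtlas τ],
    ContMDiffOn 𝓘(ℝ, CSpace n) 𝓘(ℝ, ℝ) ∞ (fun x => normSq x (τ.symm x 1)) τ.baseSet

variable {L}

/-- The zero divisor of the holomorphic section `S` is smooth and reduced: in a local
trivialization, the differential of `S` does not vanish at any zero of `S`. So `S` is a defining
section of the smooth hypersurface `{S = 0}`. -/
def HasSmoothZeroDivisor (S : Cₛ^ω⟮𝓘(ℂ, CSpace n); ℂ, L⟯) : Prop :=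
  ∀ x : M, S x = 0 →
    mfderiv 𝓘(ℂ, CSpace n) 𝓘(ℂ, ℂ) (fun y => (trivializationAt ℂ L x ⟨y, S y⟩).2) x ≠ 0

/-- The divisor `D = {S = 0}`. -/
def divisor (S : Cₛ^ω⟮𝓘(ℂ, CSpace n); ℂ, L⟯) : Set M := {x | S x = 0}

/-- The function `|S|²`. -/
def sqNorm (H : HermitianMetric n L) (S : Cₛ^ω⟮𝓘(ℂ, CSpace n); ℂ, L⟯) (x : M) : ℝ :=
  H.normSq x (S x)

/-- The potential `δ |S|^{2β}` of the model conical metric `ω_D = ω₀ + δ √-1 ∂∂̄|S|^{2β}`. -/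
def modelPotential (H : HermitianMetric n L) (S : Cₛ^ω⟮𝓘(ℂ, CSpace n); ℂ, L⟯) (β δ : ℝ)
    (x : M) : ℝ :=
  δ * sqNorm H S x ^ β

/-- `ω_D = ω₀ + δ √-1 ∂∂̄|S|^{2β}` is positive definite on `M ∖ D`; this holds for all small
`δ > 0`. -/
def ModelPositive (ω₀ : KahlerForm n M) (H : HermitianMetric n L)
    (S : Cₛ^ω⟮𝓘(ℂ, CSpace n); ℂ, L⟯) (β δ : ℝ) : Prop :=
  ∀ e ∈ atlas (CSpace n) M, ∀ z ∈ e.target, e.symm z ∉ divisor S →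
    (ω₀.potMatrix (modelPotential H S β δ) e z).PosDef

/-- `φ` is (the potential of) a weak conical Kähler-Ricci flow on `[0,T]` with initial value `φ₀`,
where `h` is the function in the flow equation and `ω_φ = ω₀ + √-1 ∂∂̄φ`. -/
structure IsWeakConicalFlow (ω₀ : KahlerForm n M) (H : HermitianMetric n L)
    (S : Cₛ^ω⟮𝓘(ℂ, CSpace n); ℂ, L⟯) (β δ α T : ℝ) (h φ₀ : M → ℝ) (φ : ℝ → M → ℝ) : Prop where
  initial : φ 0 = φ₀
  holder : ParabolicHolder n α T φ
  /-- `φ(t)` is twice continuously differentiable away from `D`. -/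
  contMDiffOn : ∀ t ∈ Set.Ioo 0 T,
    ContMDiffOn 𝓘(ℝ, CSpace n) 𝓘(ℝ, ℝ) 2 (φ t) (divisor S)ᶜ
  /-- `∂φ/∂t = log (ω_φⁿ / ω₀ⁿ) + β φ + h + (1 - β) log |S|²` on `M ∖ D`. -/
  flow : ∀ t ∈ Set.Ioo 0 T, ∀ e ∈ atlas (CSpace n) M, ∀ z ∈ e.target, e.symm z ∉ divisor S →
    HasDerivAt (fun s => φ s (e.symm z))
      (Real.log (ω₀.volRatio (φ t) e z) + β * φ t (e.symm z) + h (e.symm z)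
        + (1 - β) * Real.log (sqNorm H S (e.symm z))) t
  /-- `ω_D / C ≤ ω_φ ≤ C ω_D` on `M ∖ D`. -/
  quasiIsometric : ∃ C : ℝ, 0 < C ∧ ∀ t ∈ Set.Ioo 0 T, ∀ e ∈ atlas (CSpace n) M,
    ∀ z ∈ e.target, e.symm z ∉ divisor S →
      (ω₀.potMatrix (φ t) e z - C⁻¹ • ω₀.potMatrix (modelPotential H S β δ) e z).PosSemidef ∧
      (C • ω₀.potMatrix (modelPotential H S β δ) e z - ω₀.potMatrix (φ t) e z).PosSemidef
  /-- `|∂φ/∂t| ≤ C` on `M ∖ D`. -/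
  deriv_bounded : ∃ C : ℝ, ∀ t ∈ Set.Ioo 0 T, ∀ x ∉ divisor S,
    |deriv (fun s => φ s x) t| ≤ C

end Background

end ConicalKRF

end

/-! The proof is a parabolic maximum principle with a logarithmic barrier. The factor `e^{-βt}`
absorbs the zeroth order term, and the difference of the flow equations no longer contains `h` or
`log |S|²`. The one obstacle is that a maximum of `φ₁ - φ₂` may lie on `D`, where no equation holds.
Adding `ε log |S|²`, which is `-∞` on `D`, pushes the maximum off `D`.

The barrier costs little. Off `D`, `i∂∂̄ log |S|²` extends to minus a smooth curvature form, hence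
is at least `-C₀ ω₀` (`exists_curvature_bound`). Subtracting `ε C₀ δ |S|^{2β}` as well turns the
error `ε C₀ ω₀` into `ε C₀ ω_D ≤ ε C₀ C₂ ω_{φ₂}`. So at a spatial maximum `ω_{φ₁} ≤ (1 + O(ε))
ω_{φ₂}`, and the logarithms of the volume forms differ by `O(ε)` (`log_det_sub_le_of_isLocalMax`). A
term `-ε K t` with `K` large rules out a maximum at positive time.

Comparison with time `0` bounds `e^{-βt} (φ₁ - φ₂)` at a point off `D` by `ε` times a constant
depending on the point. Letting `ε → 0` and exchanging the flows gives equality off `D`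
(`IsWeakConicalFlow.eq_of_notMem_divisor`). Continuity and density extend it to `D` and to the end
times. -/

noncomputable section

namespace ConicalKRF

open Topology Filter

/-! ### Hermitian forms and determinant comparison. -/

section LinearAlgebra

variable {n : ℕ}

/-- The real Hermitian form `∑ A_{ij} w_i w̄_j`. -/
def hermForm (A : Matrix (Fin n) (Fin n) ℂ) (w : CSpace n) : ℝ :=
  (∑ i, ∑ j, A i j * (w i * starRingEnd ℂ (w j))).re

lemma hermForm_add (A B : Matrix (Fin n) (Fin n) ℂ) (w : CSpace n) :
    hermForm (A + B) w = hermForm A w + hermForm B w := by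
  simp [hermForm, add_mul, Finset.sum_add_distrib]

lemma hermForm_sub (A B : Matrix (Fin n) (Fin n) ℂ) (w : CSpace n) :
    hermForm (A - B) w = hermForm A w - hermForm B w := by
  simp [hermForm, sub_mul, Finset.sum_sub_distrib]

lemma hermForm_smul (c : ℝ) (A : Matrix (Fin n) (Fin n) ℂ) (w : CSpace n) :
    hermForm (c • A) w = c * hermForm A w := by
  simp only [hermForm, Matrix.smul_apply, Complex.real_smul, mul_assoc, ← Finset.mul_sum,
    Complex.re_ofReal_mul]

lemma hermForm_smul_vec (A : Matrix (Fin n) (Fin n) ℂ) (c : ℝ) (w : CSpace n) :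
    hermForm A ((c : ℂ) • w) = c ^ 2 * hermForm A w := by
  rw [hermForm, hermForm, ← Complex.re_ofReal_mul]
  simp only [Finset.mul_sum]
  congr 1
  refine Finset.sum_congr rfl fun i _ => Finset.sum_congr rfl fun j _ => ?_
  simp
  ring

/-- Matrix positivity tests `∑ A_{ij} x̄_i x_j`, while a metric pairs `A_{ij}` with `w_i w̄_j`; the
two conventions match for `w = x̄`. -/
lemma dotProduct_mulVec_re (A : Matrix (Fin n) (Fin n) ℂ) (x : Fin n → ℂ) :
    (star x ⬝ᵥ (A.mulVec x)).re = hermForm A (WithLp.toLp 2 (star x)) := by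
  simp only [hermForm, dotProduct, Matrix.mulVec, Finset.mul_sum]
  congr 1
  refine Finset.sum_congr rfl fun i _ => Finset.sum_congr rfl fun j _ => ?_
  simp
  ring

lemma posSemidef_of_hermForm {A : Matrix (Fin n) (Fin n) ℂ} (hA : A.IsHermitian)
    (h : ∀ w, 0 ≤ hermForm A w) : A.PosSemidef := by
  refine .of_dotProduct_mulVec_nonneg hA fun x => ?_
  rw [Complex.nonneg_iff]
  refine ⟨by rw [dotProduct_mulVec_re]; exact h _, ?_⟩
  exact (hA.im_star_dotProduct_mulVec_self x).symm

lemma posDef_of_hermForm {A : Matrix (Fin n) (Fin n) ℂ} (hA : A.IsHermitian)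
    (h : ∀ w, w ≠ 0 → 0 < hermForm A w) : A.PosDef := by
  refine .of_dotProduct_mulVec_pos hA fun x hx => ?_
  rw [Complex.pos_iff]
  refine ⟨?_, (hA.im_star_dotProduct_mulVec_self x).symm⟩
  rw [dotProduct_mulVec_re]
  refine h _ fun h0 => hx ?_
  have : star x = 0 := by simpa using h0
  simpa using this

lemma hermForm_nonneg {A : Matrix (Fin n) (Fin n) ℂ} (hA : A.PosSemidef) (w : CSpace n) :
    0 ≤ hermForm A w := by
  have h := (Complex.nonneg_iff.1 (hA.dotProduct_mulVec_nonneg (star (WithLp.ofLp w)))).1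
  rw [dotProduct_mulVec_re] at h
  simpa using h

/-- If `0 < A ≤ c B` as Hermitian matrices, then `det A ≤ cⁿ det B`. -/
lemma det_le_of_le_smul {A B : Matrix (Fin n) (Fin n) ℂ} (hA : A.PosDef) (hB : B.PosDef) {c : ℝ}
    (h : (c • B - A).PosSemidef) : A.det.re ≤ c ^ n * B.det.re := by
  -- Writing `B = P* P` and conjugating by `P⁻¹` reduces to `B = 1`, where the claim bounds a
  -- product of eigenvalues in `[0, c]`.
  obtain ⟨P, hP, rfl⟩ : ∃ P : Matrix (Fin n) (Fin n) ℂ, IsUnit P.det ∧ B = P.conjTranspose * P := by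
    open scoped MatrixOrder Matrix.Norms.L2Operator in
    obtain ⟨P, hP, h⟩ := CStarAlgebra.isStrictlyPositive_iff_eq_star_mul_self.mp
      hB.isStrictlyPositive
    exact ⟨P, (Matrix.isUnit_iff_isUnit_det P).1 hP, h⟩
  set A' := (P⁻¹).conjTranspose * A * P⁻¹ with hA'
  have hPP : P * P⁻¹ = 1 := Matrix.mul_nonsing_inv P hP
  have hPP' : P⁻¹ * P = 1 := Matrix.nonsing_inv_mul P hP
  have hPs : (P⁻¹).conjTranspose * P.conjTranspose = 1 := by
    rw [← Matrix.conjTranspose_mul, hPP, Matrix.conjTranspose_one]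
  have hPs' : P.conjTranspose * (P⁻¹).conjTranspose = 1 := by
    rw [← Matrix.conjTranspose_mul, hPP', Matrix.conjTranspose_one]
  have hA'pos : A'.PosSemidef := hA.posSemidef.conjTranspose_mul_mul_same P⁻¹
  have hle : (c • (1 : Matrix (Fin n) (Fin n) ℂ) - A').PosSemidef := by
    have := h.conjTranspose_mul_mul_same P⁻¹
    have e : (P⁻¹).conjTranspose * (c • (P.conjTranspose * P) - A) * P⁻¹ = c • 1 - A' := by
      rw [Matrix.mul_sub, Matrix.sub_mul, Matrix.mul_smul, Matrix.smul_mul, ← Matrix.mul_assoc, hPs,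
        Matrix.one_mul, hPP]
    rwa [e] at this
  have hAeq : A = P.conjTranspose * A' * P := by
    simp only [hA', ← Matrix.mul_assoc, hPs', Matrix.one_mul]
    rw [Matrix.mul_assoc, hPP', Matrix.mul_one]
  have hdet : A.det = A'.det * (P.conjTranspose * P).det := by
    conv_lhs => rw [hAeq]
    simp only [Matrix.det_mul]; ring
  -- Testing `c - A' ≥ 0` on a unit eigenvector bounds its eigenvalue.
  have hev : ∀ i, hA'pos.1.eigenvalues i ≤ c := by
    intro i
    have h1 := (Complex.nonneg_iff.1
      (hle.dotProduct_mulVec_nonneg (hA'pos.1.eigenvectorBasis i))).1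
    have h2 := hA'pos.1.mulVec_eigenvectorBasis i
    have hn : star (WithLp.ofLp (hA'pos.1.eigenvectorBasis i)) ⬝ᵥ
        (WithLp.ofLp (hA'pos.1.eigenvectorBasis i)) = 1 := by
      have := hA'pos.1.eigenvectorBasis.orthonormal.1 i
      have h3 : inner ℂ (hA'pos.1.eigenvectorBasis i) (hA'pos.1.eigenvectorBasis i) = (1 : ℂ) := by
        rw [inner_self_eq_norm_sq_to_K, this]; simp
      rw [EuclideanSpace.inner_eq_star_dotProduct, dotProduct_comm] at h3
      exact h3
    rw [Matrix.sub_mulVec, Matrix.smul_mulVec, Matrix.one_mulVec, h2, dotProduct_sub,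
      dotProduct_smul, dotProduct_smul, hn] at h1
    simpa using h1
  have hdet' : A'.det = ((∏ i, hA'pos.1.eigenvalues i : ℝ) : ℂ) := by
    rw [hA'pos.1.det_eq_prod_eigenvalues]; simp
  have hBpos : 0 ≤ (P.conjTranspose * P).det.re := (Complex.pos_iff.1 hB.det_pos).1.le
  rw [hdet, hdet', Complex.re_ofReal_mul]
  gcongr
  calc ∏ i, hA'pos.1.eigenvalues i ≤ ∏ _i : Fin n, c :=
        Finset.prod_le_prod (fun i _ => hA'pos.eigenvalues_nonneg i) fun i _ => hev i
    _ = c ^ n := by simp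

lemma re_div_det {A G : Matrix (Fin n) (Fin n) ℂ} (hA : A.PosDef) (hG : G.PosDef) :
    (A.det / G.det).re = A.det.re / G.det.re := by
  have h1 := (Complex.pos_iff.1 hA.det_pos).2
  have h2 := (Complex.pos_iff.1 hG.det_pos).2
  have e1 : A.det = (A.det.re : ℂ) := Complex.ext rfl (by simp [← h1])
  have e2 : G.det = (G.det.re : ℂ) := Complex.ext rfl (by simp [← h2])
  rw [e1, e2, ← Complex.ofReal_div]
  simp

/-- If `0 < A ≤ (1 + η) B` and `0 < G`, then `log (det A / det G) ≤ log (det B / det G) + n η`. -/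
lemma log_det_ratio_le {A B G : Matrix (Fin n) (Fin n) ℂ} (hA : A.PosDef) (hB : B.PosDef)
    (hG : G.PosDef) {η : ℝ} (hη : 0 ≤ η) (h : ∀ w, hermForm (A - B) w ≤ η * hermForm B w) :
    Real.log (A.det / G.det).re ≤ Real.log (B.det / G.det).re + n * η := by
  have ha : 0 < A.det.re := (Complex.pos_iff.1 hA.det_pos).1
  have hb : 0 < B.det.re := (Complex.pos_iff.1 hB.det_pos).1
  have hg : 0 < G.det.re := (Complex.pos_iff.1 hG.det_pos).1
  have hPS : ((1 + η) • B - A).PosSemidef := by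
    refine posSemidef_of_hermForm ((hB.1.smul (IsSelfAdjoint.all _)).sub hA.1) fun w => ?_
    have := h w
    rw [hermForm_sub] at this
    rw [hermForm_sub, hermForm_smul]
    linarith
  have hdet := det_le_of_le_smul hA hB hPS
  rw [re_div_det hA hG, re_div_det hB hG, Real.log_div ha.ne' hg.ne', Real.log_div hb.ne' hg.ne']
  have h1 : Real.log A.det.re ≤ Real.log ((1 + η) ^ n * B.det.re) := Real.log_le_log ha hdet
  rw [Real.log_mul (by positivity) hb.ne', Real.log_pow] at h1
  have h2 : Real.log (1 + η) ≤ η := by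
    have := Real.log_le_sub_one_of_pos (x := 1 + η) (by positivity)
    linarith
  have h3 : (n : ℝ) * Real.log (1 + η) ≤ n * η := by gcongr
  linarith

end LinearAlgebra

/-! ### The Levi form, pluriharmonicity and second order conditions. -/

section LeviForm

variable {n : ℕ}

/-- Four times the Levi form of `u` at `z`: the Laplacian of `ζ ↦ u (z + ζ w)` at `0`. -/
def leviForm (u : CSpace n → ℝ) (z w : CSpace n) : ℝ :=
  fderiv ℝ (fderiv ℝ u) z w w + fderiv ℝ (fderiv ℝ u) z (Complex.I • w) (Complex.I • w)

lemma sum_sesquilinear (B : CSpace n →ₗ[ℂ] CSpace n →ₗ⋆[ℂ] ℂ) (w : CSpace n) :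
    ∑ i, ∑ j, B (EuclideanSpace.single i 1) (EuclideanSpace.single j 1)
      * (w i * starRingEnd ℂ (w j)) = B w w := by
  have hw : w = ∑ i, w i • EuclideanSpace.single i (1 : ℂ) := by
    ext k
    simp [Finset.sum_apply, Pi.single_apply]
  conv_rhs => rw [hw]
  simp only [map_sum, LinearMap.sum_apply, map_smul, LinearMap.smul_apply, LinearMap.map_smulₛₗ,
    smul_eq_mul, Finset.mul_sum]
  rw [Finset.sum_comm]
  refine Finset.sum_congr rfl fun i _ => Finset.sum_congr rfl fun j _ => ?_
  ring

/-- The sesquilinear form attached to a real bilinear form on `ℂⁿ`. -/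
def sesquilinearOfReal (Q : CSpace n →L[ℝ] CSpace n →L[ℝ] ℝ) :
    CSpace n →ₗ[ℂ] CSpace n →ₗ⋆[ℂ] ℂ :=
  LinearMap.mk₂'ₛₗ _ _
    (fun v w => ((Q v w + Q (Complex.I • v) (Complex.I • w) : ℝ) : ℂ)
      + Complex.I * ((Q v (Complex.I • w) - Q (Complex.I • v) w : ℝ) : ℂ))
    (by intro a b c; simp only [smul_add, map_add, add_apply]; push_cast; ring)
    (by
      intro c v w
      have e : c • v = c.re • v + c.im • (Complex.I • v) := by
        ext k; simp only [PiLp.smul_apply, PiLp.add_apply, smul_eq_mul, Complex.real_smul]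
        nth_rw 1 [← Complex.re_add_im c]; ring
      have e' : Complex.I • c • v = c.re • (Complex.I • v) - c.im • v := by
        ext k; simp only [PiLp.smul_apply, PiLp.sub_apply, smul_eq_mul, Complex.real_smul]
        nth_rw 1 [← Complex.re_add_im c]; linear_combination c.im * v k * Complex.I_sq
      rw [e', e]
      simp only [map_add, map_sub, map_smul, add_apply,
        sub_apply, smul_apply, smul_eq_mul, RingHom.id_apply]
      conv_rhs => rw [← Complex.re_add_im c]
      push_cast
      linear_combination (-(c.im : ℂ) * (Q v (Complex.I • w) - Q (Complex.I • v) w)) * Complex.I_sq)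
    (by intro a b c; simp only [smul_add, map_add]; push_cast; ring)
    (by
      intro c w v
      have e : c • v = c.re • v + c.im • (Complex.I • v) := by
        ext k; simp only [PiLp.smul_apply, PiLp.add_apply, smul_eq_mul, Complex.real_smul]
        nth_rw 1 [← Complex.re_add_im c]; ring
      have e' : Complex.I • c • v = c.re • (Complex.I • v) - c.im • v := by
        ext k; simp only [PiLp.smul_apply, PiLp.sub_apply, smul_eq_mul, Complex.real_smul]
        nth_rw 1 [← Complex.re_add_im c]; linear_combination c.im * v k * Complex.I_sq
      have ec : starRingEnd ℂ c = c.re - c.im * Complex.I := by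
        apply Complex.ext <;> simp
      rw [e', e]
      simp only [map_add, map_sub, map_smul, smul_eq_mul, ec]
      push_cast
      linear_combination ((c.im : ℂ) * (Q w (Complex.I • v) - Q (Complex.I • w) v)) * Complex.I_sq)

lemma eventually_contDiffAt {E F : Type*} [NormedAddCommGroup E] [NormedSpace ℝ E]
    [NormedAddCommGroup F] [NormedSpace ℝ F] {u : E → F} {z : E} (hu : ContDiffAt ℝ 2 u z) :
    ∀ᶠ y in 𝓝 z, DifferentiableAt ℝ u y :=
  (hu.eventually (by simp)).mono fun _ h => h.differentiableAt (by simp)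

lemma differentiableAt_fderiv {E F : Type*} [NormedAddCommGroup E] [NormedSpace ℝ E]
    [NormedAddCommGroup F] [NormedSpace ℝ F] {u : E → F} {z : E} (hu : ContDiffAt ℝ 2 u z) :
    DifferentiableAt ℝ (fderiv ℝ u) z :=
  (hu.fderiv_right (m := 1) (by norm_num)).differentiableAt (by simp)

lemma single_I (k : Fin n) :
    EuclideanSpace.single k Complex.I = Complex.I • EuclideanSpace.single k (1 : ℂ) := by
  ext i
  simp

/-- This expands `∂_i ∂_{j̄} = (∂_{x_i} - i ∂_{y_i})(∂_{x_j} + i ∂_{y_j}) / 4`; the four real second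
derivatives are exactly those in `sesquilinearOfReal`. -/
lemma complexHessian_eq {u : CSpace n → ℝ} {z : CSpace n} (hu : ContDiffAt ℝ 2 u z) (i j : Fin n) :
    complexHessian u z i j = sesquilinearOfReal (fderiv ℝ (fderiv ℝ u) z)
      (EuclideanSpace.single i 1) (EuclideanSpace.single j 1) / 4 := by
  have h1 : (fun w => dzbar j (fun y => (u y : ℂ)) w) =ᶠ[𝓝 z] fun w =>
      ((fderiv ℝ u w (EuclideanSpace.single j 1) : ℂ)
        + Complex.I * (fderiv ℝ u w (Complex.I • EuclideanSpace.single j 1) : ℂ)) / 2 := by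
    filter_upwards [eventually_contDiffAt hu] with y hy
    have : fderiv ℝ (fun y => (u y : ℂ)) y = Complex.ofRealCLM.comp (fderiv ℝ u y) :=
      (Complex.ofRealCLM.hasFDerivAt.comp y hy.hasFDerivAt).fderiv
    simp [dzbar, this, single_I]
  have hd := (differentiableAt_fderiv hu).hasFDerivAt
  have h2 : ∀ v, HasFDerivAt (fun w => (fderiv ℝ u w v : ℂ))
      (Complex.ofRealCLM.comp ((ContinuousLinearMap.apply ℝ ℝ v).comp
        (fderiv ℝ (fderiv ℝ u) z))) z := fun v =>
    Complex.ofRealCLM.hasFDerivAt.comp z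
      ((ContinuousLinearMap.apply ℝ ℝ v).hasFDerivAt.comp z hd)
  have h3 := ((h2 (EuclideanSpace.single j 1)).add
    ((h2 (Complex.I • EuclideanSpace.single j 1)).const_mul Complex.I)).mul_const (2⁻¹ : ℂ)
  simp only [complexHessian, Matrix.of_apply]
  rw [dz, h1.fderiv_eq]
  simp only [div_eq_mul_inv]
  erw [h3.fderiv]
  simp only [sesquilinearOfReal, LinearMap.mk₂'ₛₗ_apply, single_I]
  simp
  linear_combination (-(1 / 4 : ℂ) * (fderiv ℝ (fderiv ℝ u) z (Complex.I • EuclideanSpace.single i 1)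
    (Complex.I • EuclideanSpace.single j 1))) * Complex.I_sq

lemma hermForm_complexHessian {u : CSpace n → ℝ} {z : CSpace n} (hu : ContDiffAt ℝ 2 u z)
    (w : CSpace n) : hermForm (complexHessian u z) w = leviForm u z w / 4 := by
  have h : ∑ i, ∑ j, complexHessian u z i j * (w i * starRingEnd ℂ (w j))
      = sesquilinearOfReal (fderiv ℝ (fderiv ℝ u) z) w w / 4 := by
    rw [← sum_sesquilinear, Finset.sum_div]
    refine Finset.sum_congr rfl fun i _ => ?_
    rw [Finset.sum_div]
    refine Finset.sum_congr rfl fun j _ => ?_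
    rw [complexHessian_eq hu]
    ring
  rw [hermForm, h]
  simp [sesquilinearOfReal, leviForm]

lemma leviForm_congr {u v : CSpace n → ℝ} {z : CSpace n} (h : u =ᶠ[𝓝 z] v) (w : CSpace n) :
    leviForm u z w = leviForm v z w := by
  have := (h.fderiv (𝕜 := ℝ)).fderiv_eq (𝕜 := ℝ)
  rw [leviForm, leviForm, this]

lemma leviForm_add {u v : CSpace n → ℝ} {z : CSpace n} (hu : ContDiffAt ℝ 2 u z)
    (hv : ContDiffAt ℝ 2 v z) (w : CSpace n) :
    leviForm (fun y => u y + v y) z w = leviForm u z w + leviForm v z w := by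
  have h1 : fderiv ℝ (fun y => u y + v y) =ᶠ[𝓝 z] fun y => fderiv ℝ u y + fderiv ℝ v y := by
    filter_upwards [eventually_contDiffAt hu, eventually_contDiffAt hv] with y h h'
    exact fderiv_fun_add h h'
  rw [leviForm, h1.fderiv_eq,
    fderiv_fun_add (differentiableAt_fderiv hu) (differentiableAt_fderiv hv), leviForm, leviForm]
  simp only [add_apply]
  ring

lemma leviForm_const_mul {u : CSpace n → ℝ} {z : CSpace n} (hu : ContDiffAt ℝ 2 u z) (c : ℝ)
    (w : CSpace n) : leviForm (fun y => c * u y) z w = c * leviForm u z w := by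
  have h1 : fderiv ℝ (fun y => c * u y) =ᶠ[𝓝 z] fun y => c • fderiv ℝ u y := by
    filter_upwards [eventually_contDiffAt hu] with y h
    exact fderiv_const_mul h c
  rw [leviForm, h1.fderiv_eq, fderiv_fun_const_smul (differentiableAt_fderiv hu), leviForm]
  simp only [smul_apply, smul_eq_mul]
  ring

lemma leviForm_smul (u : CSpace n → ℝ) (z : CSpace n) (c : ℝ) (w : CSpace n) :
    leviForm u z ((c : ℂ) • w) = c ^ 2 * leviForm u z w := by
  have e : (c : ℂ) • w = c • w := by ext; simp
  have e' : Complex.I • c • w = c • (Complex.I • w) := smul_comm _ _ _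
  simp only [leviForm, e, e', map_smul, smul_apply, smul_eq_mul]
  ring

/-- The second order necessary condition at a local maximum. -/
lemma fderiv_fderiv_nonpos_of_isLocalMax {E : Type*} [NormedAddCommGroup E] [NormedSpace ℝ E]
    {u : E → ℝ} {z : E} (hu : ContDiffAt ℝ 2 u z) (hm : IsLocalMax u z) (w : E) :
    fderiv ℝ (fderiv ℝ u) z w w ≤ 0 := by
  by_contra! hpos
  set g : ℝ → ℝ := fun t => u (z + t • w) with hg
  have hl : ∀ t : ℝ, HasDerivAt (fun t : ℝ => z + t • w) w t := fun t => by
    simpa using ((hasDerivAt_id t).smul_const w).const_add z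
  have h0 : z + (0 : ℝ) • w = z := by simp
  have hc : Filter.Tendsto (fun t : ℝ => z + t • w) (𝓝 0) (𝓝 z) := by
    simpa using (hl 0).continuousAt.tendsto
  have hg' : deriv g =ᶠ[𝓝 0] fun t => fderiv ℝ u (z + t • w) w := by
    filter_upwards [hc.eventually (eventually_contDiffAt hu)] with t ht
    exact (ht.hasFDerivAt.comp_hasDerivAt t (hl t)).deriv
  have hg'' : deriv (deriv g) 0 = fderiv ℝ (fderiv ℝ u) z w w := by
    rw [hg'.deriv_eq]
    have hd : HasFDerivAt (fderiv ℝ u) (fderiv ℝ (fderiv ℝ u) z) (z + (0 : ℝ) • w) := by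
      rw [h0]; exact (differentiableAt_fderiv hu).hasFDerivAt
    have := (ContinuousLinearMap.apply ℝ ℝ w).hasFDerivAt.comp_hasDerivAt (0 : ℝ)
      (hd.comp_hasDerivAt (0 : ℝ) (hl 0))
    exact this.deriv
  have hgm : IsLocalMax g 0 := by
    have := hc.eventually hm
    filter_upwards [this] with t ht
    simpa [hg] using ht
  have hgc : ContinuousAt g 0 := by
    refine ContinuousAt.comp (g := u) ?_ (hl 0).continuousAt
    rw [h0]; exact hu.continuousAt
  -- A positive second derivative would make `0` a local minimum as well, so `g` would be locally
  -- constant and its second derivative zero.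
  have hmin := isLocalMin_of_deriv_deriv_pos (by rw [hg'']; exact hpos) hgm.deriv_eq_zero hgc
  have hconst : g =ᶠ[𝓝 0] fun _ => g 0 := by
    filter_upwards [hgm, hmin] with t h1 h2
    exact le_antisymm h1 h2
  have h1 : deriv g =ᶠ[𝓝 0] fun _ => 0 := by
    simpa using hconst.deriv
  rw [← hg'', h1.deriv_eq] at hpos
  simp at hpos

lemma leviForm_nonpos_of_isLocalMax {u : CSpace n → ℝ} {z : CSpace n} (hu : ContDiffAt ℝ 2 u z)
    (hm : IsLocalMax u z) (w : CSpace n) : leviForm u z w ≤ 0 :=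
  add_nonpos (fderiv_fderiv_nonpos_of_isLocalMax hu hm _)
    (fderiv_fderiv_nonpos_of_isLocalMax hu hm _)

/-- The logarithm of the modulus of a nonvanishing holomorphic function is pluriharmonic. -/
lemma leviForm_log_norm {f : CSpace n → ℂ} {z : CSpace n} (hf : AnalyticAt ℂ f z) (h0 : f z ≠ 0)
    (w : CSpace n) : leviForm (fun y => Real.log ‖f y‖) z w = 0 := by
  set u : CSpace n → ℝ := fun y => Real.log ‖f y‖ with hu'
  have hu : ContDiffAt ℝ 2 u z :=
    ((hf.contDiffAt.restrict_scalars ℝ).norm ℝ h0).log (by simpa using h0)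
  set ℓ : ℂ →L[ℝ] CSpace n :=
    ((ContinuousLinearMap.id ℂ ℂ).smulRight w).restrictScalars ℝ with hℓ
  have hla : ∀ ζ, HasFDerivAt (fun ζ => z + ℓ ζ) ℓ ζ := fun ζ => ℓ.hasFDerivAt.const_add z
  have hz : z + ℓ 0 = z := by simp
  have hc : Filter.Tendsto (fun ζ => z + ℓ ζ) (𝓝 0) (𝓝 z) := by
    simpa using (hla 0).continuousAt.tendsto
  have hfa : AnalyticAt ℂ (fun ζ : ℂ => f (z + ζ • w)) 0 := by
    refine AnalyticAt.fun_comp (g := f) (f := fun ζ : ℂ => z + ζ • w) (by simpa using hf) ?_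
    fun_prop
  -- On the complex line through `z` in direction `w`, the function is the log modulus of a
  -- holomorphic function of one variable, whose Laplacian at `0` is the Levi form.
  have hharm := (hfa.harmonicAt_log_norm (by simpa using h0)).2.eq_of_nhds
  have h1 : fderiv ℝ (fun ζ => u (z + ℓ ζ)) =ᶠ[𝓝 0] fun ζ => (fderiv ℝ u (z + ℓ ζ)).comp ℓ := by
    filter_upwards [hc.eventually (eventually_contDiffAt hu)] with ζ hζ
    exact (hζ.hasFDerivAt.comp ζ (hla ζ)).fderiv
  have hd := (differentiableAt_fderiv hu).hasFDerivAt
  rw [← hz] at hd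
  have h2 := (hd.comp 0 (hla 0)).clm_comp (hasFDerivAt_const ℓ (0 : ℂ))
  have h3 : ∀ a b, fderiv ℝ (fderiv ℝ (fun ζ => u (z + ℓ ζ))) 0 a b
      = fderiv ℝ (fderiv ℝ u) z (ℓ a) (ℓ b) := by
    intro a b
    rw [h1.fderiv_eq]
    erw [h2.fderiv]
    simp
  rw [InnerProductSpace.laplacian_eq_iteratedFDeriv_complexPlane] at hharm
  simp only [iteratedFDeriv_two_apply] at hharm
  have h4 : (fun ζ : ℂ => Real.log ‖f (z + ζ • w)‖) = fun ζ => u (z + ℓ ζ) := by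
    ext ζ; simp [hu', hℓ]
  rw [h4] at hharm
  simp only [Matrix.cons_val_zero, Matrix.cons_val_one, h3] at hharm
  simpa [leviForm, hℓ] using hharm

/-- On compact sets, the Levi form of a `C²` function is bounded below by a continuous positive
definite Hermitian form. -/
lemma exists_leviForm_lower_bound {U K : Set (CSpace n)} (hU : IsOpen U) (hK : IsCompact K)
    (hKU : K ⊆ U) {u : CSpace n → ℝ} (hu : ContDiffOn ℝ 2 u U)
    {G : CSpace n → Matrix (Fin n) (Fin n) ℂ} (hG : ∀ i j, ContinuousOn (fun z => G z i j) U)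
    (hpos : ∀ z ∈ U, ∀ w, w ≠ 0 → 0 < hermForm (G z) w) :
    ∃ C, 0 ≤ C ∧ ∀ z ∈ K, ∀ w, 0 ≤ C * hermForm (G z) w + leviForm u z w / 4 := by
  have hd : ContinuousOn (fderiv ℝ (fderiv ℝ u)) U :=
    ((hu.fderiv_of_isOpen hU (m := 1) (by norm_num)).fderiv_of_isOpen hU (m := 0)
      (by norm_num)).continuousOn
  set P := K ×ˢ Metric.sphere (0 : CSpace n) 1 with hP
  have hPc : IsCompact P := hK.prod (isCompact_sphere _ _)
  have hfst : Set.MapsTo Prod.fst P U := fun p hp => hKU hp.1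
  have c1 : ContinuousOn (fun p : CSpace n × CSpace n => leviForm u p.1 p.2) P := by
    have h1 := hd.comp continuousOn_fst hfst
    have h2 : ContinuousOn (fun p : CSpace n × CSpace n => Complex.I • p.2) P :=
      (continuous_snd.const_smul Complex.I).continuousOn
    exact ((h1.clm_apply continuousOn_snd).clm_apply continuousOn_snd).add
      ((h1.clm_apply h2).clm_apply h2)
  have c2 : ContinuousOn (fun p : CSpace n × CSpace n => hermForm (G p.1) p.2) P := by
    refine Complex.continuous_re.comp_continuousOn ?_
    refine continuousOn_finsetSum _ fun i _ => continuousOn_finsetSum _ fun j _ => ?_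
    refine ((hG i j).comp continuousOn_fst hfst).mul (Continuous.continuousOn ?_)
    fun_prop
  have hposP : ∀ p ∈ P, 0 < hermForm (G p.1) p.2 := fun p hp =>
    hpos _ (hfst hp) _ (by
      have : ‖p.2‖ = 1 := by simpa using hp.2
      intro h0; simp [h0] at this)
  -- Both forms are quadratic in `w`, so it suffices to bound their quotient on the compact set `K ×
  -- sphere`.
  obtain ⟨b, hb⟩ := hPc.bddAbove_image
    ((c1.neg.div_const 4).div c2 fun p hp => (hposP p hp).ne')
  refine ⟨max b 0, le_max_right _ _, fun z hz w => ?_⟩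
  rcases eq_or_ne w 0 with rfl | hw
  · simp [hermForm, leviForm]
  have hn : (0 : ℝ) < ‖w‖ := norm_pos_iff.2 hw
  set v : CSpace n := ((‖w‖⁻¹ : ℝ) : ℂ) • w with hv
  have hwv : w = ((‖w‖ : ℝ) : ℂ) • v := by
    rw [hv, smul_smul, ← Complex.ofReal_mul, mul_inv_cancel₀ hn.ne']; simp
  have hvP : (z, v) ∈ P := by
    refine ⟨hz, ?_⟩
    simp [hv, norm_smul, hn.ne']
  have h1 := hb (Set.mem_image_of_mem _ hvP)
  have h2 := hposP _ hvP
  change -leviForm u z v / 4 / hermForm (G z) v ≤ b at h1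
  simp only at h2
  rw [div_le_iff₀ h2] at h1
  have h3 : b * hermForm (G z) v ≤ max b 0 * hermForm (G z) v :=
    mul_le_mul_of_nonneg_right (le_max_left _ _) h2.le
  rw [hwv, hermForm_smul_vec, leviForm_smul]
  have : 0 ≤ ‖w‖ ^ 2 * (max b 0 * hermForm (G z) v + leviForm u z v / 4) := by
    refine mul_nonneg (by positivity) ?_
    linarith
  linarith

end LeviForm

/-! ### Volume comparison at a spatial maximum. -/

section LeviForm

variable {n : ℕ}

/-- Comparison of volume forms at a spatial maximum point of
`c (u₁ - u₂) + ε l - ε C₀ m`. -/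
lemma log_det_sub_le_of_isLocalMax {G : Matrix (Fin n) (Fin n) ℂ} {u₁ u₂ l m : CSpace n → ℝ}
    {z : CSpace n} (hG : G.PosDef) (h₁ : ContDiffAt ℝ 2 u₁ z) (h₂ : ContDiffAt ℝ 2 u₂ z)
    (hl : ContDiffAt ℝ 2 l z) (hm : ContDiffAt ℝ 2 m z)
    (hA : (G + complexHessian u₁ z).PosDef) (hB : (G + complexHessian u₂ z).PosDef)
    {c ε C₀ C₂ : ℝ} (hc : 0 < c) (hε : 0 ≤ ε) (hC₀ : 0 ≤ C₀) (hC₂ : 0 ≤ C₂)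
    (hlb : ∀ w, 0 ≤ C₀ * hermForm G w + leviForm l z w / 4)
    (hmb : ∀ w, hermForm (G + complexHessian m z) w
      ≤ C₂ * hermForm (G + complexHessian u₂ z) w)
    (hmax : IsLocalMax (fun y => c * u₁ y + -c * u₂ y + ε * l y + -(ε * C₀) * m y) z) :
    c * (Real.log ((G + complexHessian u₁ z).det / G.det).re
      - Real.log ((G + complexHessian u₂ z).det / G.det).re) ≤ n * (ε * C₀ * C₂) := by
  have hu₁ := contDiffAt_const (c := c) |>.mul h₁
  have hu₂ := contDiffAt_const (c := -c) |>.mul h₂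
  have hul := contDiffAt_const (c := ε) |>.mul hl
  have hum := contDiffAt_const (c := -(ε * C₀)) |>.mul hm
  -- As forms, maximality gives `c ∂∂̄(u₁ - u₂) ≤ -ε ∂∂̄l + ε C₀ ∂∂̄m ≤ ε C₀ (G + ∂∂̄m) ≤ ε C₀ C₂ (G
  -- + ∂∂̄u₂)`; dividing by `c` yields `η`.
  have hlog := log_det_ratio_le hA hB hG (η := c⁻¹ * (ε * C₀ * C₂)) (by positivity) fun w => by
    have hlevi := leviForm_nonpos_of_isLocalMax (((hu₁.add hu₂).add hul).add hum) hmax w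
    rw [leviForm_add ((hu₁.add hu₂).add hul) hum, leviForm_add (hu₁.add hu₂) hul,
      leviForm_add hu₁ hu₂, leviForm_const_mul h₁, leviForm_const_mul h₂, leviForm_const_mul hl,
      leviForm_const_mul hm] at hlevi
    have e1 := hlb w
    have e2 := hmb w
    rw [hermForm_sub, hermForm_add, hermForm_add, hermForm_complexHessian h₁,
      hermForm_complexHessian h₂]
    rw [hermForm_add, hermForm_add, hermForm_complexHessian h₂, hermForm_complexHessian hm] at e2
    rw [mul_assoc c⁻¹, ← div_eq_inv_mul, le_div_iff₀ hc]
    have e3 := mul_le_mul_of_nonneg_left e1 hε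
    have e4 := mul_le_mul_of_nonneg_left e2 (mul_nonneg hε hC₀)
    nlinarith
  have h1 := mul_le_mul_of_nonneg_left hlog hc.le
  have h2 : c * (n * (c⁻¹ * (ε * C₀ * C₂))) = n * (ε * C₀ * C₂) := by
    field_simp
  linarith

end LeviForm

/-! ### Charts, Hölder continuity and the Kähler form. -/

section Manifold

variable {n : ℕ} {M : Type*} [TopologicalSpace M] [ChartedSpace (CSpace n) M]

variable (n M) in
/-- The real manifold underlying a complex manifold. -/
lemma isManifold_real [IsManifold 𝓘(ℂ, CSpace n) ω M] : IsManifold 𝓘(ℝ, CSpace n) ω M := by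
  refine isManifold_of_contDiffOn _ _ _ fun e e' he he' => ?_
  have h := contMDiffOn_of_mem_contDiffGroupoid
    (StructureGroupoid.compatible (contDiffGroupoid ω 𝓘(ℂ, CSpace n)) he he')
  rw [contMDiffOn_iff_contDiffOn] at h
  simpa using h.restrict_scalars ℝ

/-- A differentiable function on a manifold is differentiable in each chart of the atlas. -/
lemma contDiffAt_comp_symm {𝕜 : Type*} [NontriviallyNormedField 𝕜] [NormedSpace 𝕜 (CSpace n)]
    {F : Type*} [NormedAddCommGroup F] [NormedSpace 𝕜 F] {k : ℕ∞ω}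
    [IsManifold 𝓘(𝕜, CSpace n) k M] {f : M → F} {e : OpenPartialHomeomorph M (CSpace n)}
    (he : e ∈ atlas (CSpace n) M) {z : CSpace n} (hz : z ∈ e.target)
    (hf : ContMDiffAt 𝓘(𝕜, CSpace n) 𝓘(𝕜, F) k f (e.symm z)) :
    ContDiffAt 𝕜 k (f ∘ e.symm) z := by
  rw [← contMDiffAt_iff_contDiffAt]
  exact hf.comp z (contMDiffAt_symm_of_mem_maximalAtlas
    (IsManifold.subset_maximalAtlas he) hz)

/-- Continuity across `D` and up to both end times is all that is used of the Hölder condition: it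
makes the maximum attained and lets equality pass to the closure. -/
lemma ParabolicHolder.continuousOn {α T : ℝ} (hα : 0 < α) {u : ℝ → M → ℝ}
    (hu : ParabolicHolder n α T u) :
    ContinuousOn (fun p : ℝ × M => u p.1 p.2) (Set.Icc 0 T ×ˢ Set.univ) := by
  rintro ⟨t, x⟩ ⟨ht, -⟩
  set e := chartAt (CSpace n) x
  have hx : x ∈ e.source := mem_chart_source _ x
  obtain ⟨K, hKc, hxK, hK⟩ := exists_compact_subset e.open_target (e.map_source hx)
  obtain ⟨C, hC⟩ := hu e (chart_mem_atlas _ x) K hK hKc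
  rw [ContinuousWithinAt, tendsto_iff_dist_tendsto_zero]
  have hlim : Tendsto (fun p : ℝ × M => C * (‖e p.2 - e x‖ ^ α + |p.1 - t| ^ (α / 2)))
      (𝓝[Set.Icc 0 T ×ˢ Set.univ] (t, x)) (𝓝 0) := by
    have hc : ContinuousAt (fun p : ℝ × M => C * (‖e p.2 - e x‖ ^ α + |p.1 - t| ^ (α / 2)))
        (t, x) := by
      have h1 : ContinuousAt (fun p : ℝ × M => e p.2) (t, x) :=
        (e.continuousAt hx).comp (x := (t, x)) continuousAt_snd
      refine continuousAt_const.mul (ContinuousAt.add ?_ ?_)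
      · exact (h1.sub continuousAt_const).norm.rpow_const (Or.inr hα.le)
      · exact (continuousAt_fst.sub continuousAt_const).abs.rpow_const (Or.inr (by positivity))
    have := hc.tendsto.mono_left (nhdsWithin_le_nhds (s := Set.Icc 0 T ×ˢ Set.univ))
    simpa [Real.zero_rpow hα.ne', Real.zero_rpow (half_pos hα).ne'] using this
  refine squeeze_zero' (Eventually.of_forall fun _ => dist_nonneg) ?_ hlim
  have h1 : ∀ᶠ p : ℝ × M in 𝓝 (t, x), p.2 ∈ e.source ∧ e p.2 ∈ K := by
    have := (e.open_source.mem_nhds hx)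
    have h2 := (e.continuousAt hx).preimage_mem_nhds (mem_interior_iff_mem_nhds.1 hxK)
    have h3 : ContinuousAt (Prod.snd : ℝ × M → M) (t, x) := continuousAt_snd
    exact h3.preimage_mem_nhds (Filter.inter_mem this h2)
  filter_upwards [nhdsWithin_le_nhds h1, self_mem_nhdsWithin] with p hp hpT
  have := hC (e p.2) hp.2 (e x) (interior_subset hxK) p.1 hpT.1 t ht
  rwa [e.left_inv hp.1, e.left_inv hx, ← Real.dist_eq] at this

/-- The matrix represents the pullback of `g` under `e.symm`, so its positivity follows from that of
`g` and injectivity of the derivative. -/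
lemma hermForm_coeff
    (g : (x : M) → TangentSpace 𝓘(ℂ, CSpace n) x →ₗ[ℂ] TangentSpace 𝓘(ℂ, CSpace n) x →ₗ⋆[ℂ] ℂ)
    (e : OpenPartialHomeomorph M (CSpace n)) (z w : CSpace n) :
    hermForm (coeff g e z) w = (g (e.symm z)
      (mfderiv 𝓘(ℂ, CSpace n) 𝓘(ℂ, CSpace n) e.symm z w)
      (mfderiv 𝓘(ℂ, CSpace n) 𝓘(ℂ, CSpace n) e.symm z w)).re := by
  have := sum_sesquilinear (LinearMap.mk₂'ₛₗ (RingHom.id ℂ) (starRingEnd ℂ)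
    (fun v v' => g (e.symm z)
      (mfderiv 𝓘(ℂ, CSpace n) 𝓘(ℂ, CSpace n) e.symm z v)
      (mfderiv 𝓘(ℂ, CSpace n) 𝓘(ℂ, CSpace n) e.symm z v'))
    (by intro a b c; erw [map_add, map_add]; rfl)
    (by intro a b c; erw [map_smul, map_smul]; rfl)
    (by intro a b c; erw [map_add, map_add])
    (by intro a b c; erw [map_smul, LinearMap.map_smulₛₗ])) w
  simp only [LinearMap.mk₂'ₛₗ_apply] at this
  rw [← this]
  rfl

variable [IsManifold 𝓘(ℂ, CSpace n) ω M]

lemma KahlerForm.hermForm_coeff_pos (ω₀ : KahlerForm n M)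
    {e : OpenPartialHomeomorph M (CSpace n)} (he : e ∈ atlas (CSpace n) M) {z : CSpace n}
    (hz : z ∈ e.target) {w : CSpace n} (hw : w ≠ 0) : 0 < hermForm (coeff ω₀.form e z) w := by
  have : IsManifold 𝓘(ℂ, CSpace n) 1 M := IsManifold.of_le (n := ω) le_top
  rw [hermForm_coeff]
  refine ω₀.pos _ _ fun h0 => hw ?_
  have hinj := (mdifferentiable_of_mem_atlas (I := 𝓘(ℂ, CSpace n)) he).symm.mfderiv_injective
    (x := z) hz
  exact hinj (h0.trans (map_zero _).symm)

lemma KahlerForm.posDef_coeff (ω₀ : KahlerForm n M)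
    {e : OpenPartialHomeomorph M (CSpace n)} (he : e ∈ atlas (CSpace n) M) {z : CSpace n}
    (hz : z ∈ e.target) : (coeff ω₀.form e z).PosDef := by
  refine posDef_of_hermForm ?_ fun w hw => ω₀.hermForm_coeff_pos he hz hw
  ext i j
  simp only [Matrix.conjTranspose_apply, coeff, Matrix.of_apply]
  exact (ω₀.conj_symm _ _ _).symm

end Manifold

/-! ### The norm of the section and the curvature bound. -/

section Section

variable {n : ℕ} {M : Type*} [TopologicalSpace M] [ChartedSpace (CSpace n) M]
  {L : M → Type*} [TopologicalSpace (Bundle.TotalSpace ℂ L)]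
  [∀ x, AddCommGroup (L x)] [∀ x, Module ℂ (L x)] [∀ x, TopologicalSpace (L x)]
  [FiberBundle ℂ L]

lemma sqNorm_eq_zero_iff (H : HermitianMetric n L) (S : Cₛ^ω⟮𝓘(ℂ, CSpace n); ℂ, L⟯) (x : M) :
    sqNorm H S x = 0 ↔ x ∈ divisor S := by
  refine ⟨fun h => by_contra fun hx => (H.pos x (S x) hx).ne' h, fun h => ?_⟩
  have : S x = (0 : ℂ) • (0 : L x) := by rw [zero_smul]; exact h
  rw [sqNorm, this, H.smul]
  simp

lemma sqNorm_nonneg (H : HermitianMetric n L) (S : Cₛ^ω⟮𝓘(ℂ, CSpace n); ℂ, L⟯) (x : M) :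
    0 ≤ sqNorm H S x := by
  by_cases hx : x ∈ divisor S
  · exact ((sqNorm_eq_zero_iff H S x).2 hx).ge
  · exact (H.pos x (S x) hx).le

variable [VectorBundle ℂ ℂ L]

/-- A smooth divisor has empty interior. -/
lemma HasSmoothZeroDivisor.dense_compl {S : Cₛ^ω⟮𝓘(ℂ, CSpace n); ℂ, L⟯}
    (hS : HasSmoothZeroDivisor S) : Dense (divisor S)ᶜ := by
  rw [← interior_eq_empty_iff_dense_compl, Set.eq_empty_iff_forall_notMem]
  intro x hx
  refine hS x (interior_subset (s := divisor S) hx) ?_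
  set τ := trivializationAt ℂ L x
  -- If `S` vanished on an open set, so would its local representative, and the differential at `x`
  -- would be zero, against transversality.
  have h : (fun y => (τ ⟨y, S y⟩).2) =ᶠ[𝓝 x] fun _ => (0 : ℂ) := by
    filter_upwards [mem_interior_iff_mem_nhds.1 hx,
      τ.open_baseSet.mem_nhds (FiberBundle.mem_baseSet_trivializationAt' x)] with y hy hyb
    have hy' : S y = 0 := hy
    have := (τ.continuousLinearEquivAt ℂ y hyb).map_zero
    rw [hy']
    exact this
  rw [h.mfderiv_eq]
  exact mfderiv_const

variable [IsManifold 𝓘(ℂ, CSpace n) ω M] [ContMDiffVectorBundle ω ℂ L 𝓘(ℂ, CSpace n)]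

/-- In local coordinates `|S|² = |f|² a` with `f` holomorphic and `a > 0` smooth. -/
lemma exists_local_sqNorm (H : HermitianMetric n L) (S : Cₛ^ω⟮𝓘(ℂ, CSpace n); ℂ, L⟯)
    {e : OpenPartialHomeomorph M (CSpace n)} (he : e ∈ atlas (CSpace n) M) {z₀ : CSpace n}
    (hz₀ : z₀ ∈ e.target) :
    ∃ U ⊆ e.target, IsOpen U ∧ z₀ ∈ U ∧ ∃ (f : CSpace n → ℂ) (a : CSpace n → ℝ),
      (∀ z ∈ U, AnalyticAt ℂ f z) ∧ ContDiffOn ℝ 2 a U ∧ (∀ z ∈ U, 0 < a z) ∧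
      ∀ z ∈ U, sqNorm H S (e.symm z) = ‖f z‖ ^ 2 * a z := by
  have := isManifold_real n M
  have : IsManifold 𝓘(ℝ, CSpace n) 2 M := IsManifold.of_le (n := ω) le_top
  set τ := trivializationAt ℂ L (e.symm z₀)
  have hopen : IsOpen (e.target ∩ e.symm ⁻¹' τ.baseSet) :=
    e.isOpen_inter_preimage_symm τ.open_baseSet
  -- Here `f` is `S` read in the trivialization and `a` is the squared norm of the local frame.
  refine ⟨e.target ∩ e.symm ⁻¹' τ.baseSet, Set.inter_subset_left, hopen,
    ⟨hz₀, FiberBundle.mem_baseSet_trivializationAt' _⟩,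
    (fun y => (τ ⟨y, S y⟩).2) ∘ e.symm, (fun x => H.normSq x (τ.symm x 1)) ∘ e.symm,
    fun z hz => ?_, fun z hz => ?_, fun z hz => ?_, fun z hz => ?_⟩
  · have hS : ContMDiffAt 𝓘(ℂ, CSpace n) 𝓘(ℂ, ℂ) ω (fun y => (τ ⟨y, S y⟩).2) (e.symm z) :=
      (τ.contMDiffAt_section_iff hz.2).1 S.contMDiff.contMDiffAt
    exact (contDiffAt_comp_symm he hz.1 hS).analyticAt
  · have h := (H.smooth τ).contMDiffAt (τ.open_baseSet.mem_nhds hz.2)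
    exact (contDiffAt_comp_symm he hz.1 (h.of_le (ENat.LEInfty.out (m := 2)))).contDiffWithinAt
  · refine H.pos _ _ fun h0 => ?_
    have h1 := (τ.continuousLinearEquivAt ℂ _ hz.2).symm.injective.ne (one_ne_zero (α := ℂ))
    rw [map_zero] at h1
    exact h1 h0
  · have h1 := (τ.continuousLinearEquivAt ℂ _ hz.2).symm_apply_apply (S (e.symm z))
    have h2 : S (e.symm z) = (τ ⟨e.symm z, S (e.symm z)⟩).2 • τ.symm (e.symm z) 1 := by
      have h3 := (τ.continuousLinearEquivAt ℂ _ hz.2).symm.map_smul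
        (τ ⟨e.symm z, S (e.symm z)⟩).2 (1 : ℂ)
      rw [smul_eq_mul, mul_one] at h3
      exact h1.symm.trans h3
    rw [sqNorm, h2, H.smul]
    rfl

lemma contDiffAt_sqNorm (H : HermitianMetric n L) (S : Cₛ^ω⟮𝓘(ℂ, CSpace n); ℂ, L⟯)
    {e : OpenPartialHomeomorph M (CSpace n)} (he : e ∈ atlas (CSpace n) M) {z : CSpace n}
    (hz : z ∈ e.target) : ContDiffAt ℝ 2 (sqNorm H S ∘ e.symm) z := by
  obtain ⟨U, -, hU, hzU, f, a, hf, ha, -, hfa⟩ := exists_local_sqNorm H S he hz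
  have h : sqNorm H S ∘ e.symm =ᶠ[𝓝 z] fun y => ‖f y‖ ^ 2 * a y := by
    filter_upwards [hU.mem_nhds hzU] with y hy using hfa y hy
  refine ContDiffAt.congr_of_eventuallyEq ?_ h
  exact (((hf z hzU).contDiffAt.restrict_scalars ℝ).norm_sq ℝ).mul
    (ha.contDiffAt (hU.mem_nhds hzU))

lemma continuous_sqNorm (H : HermitianMetric n L) (S : Cₛ^ω⟮𝓘(ℂ, CSpace n); ℂ, L⟯) :
    Continuous (sqNorm H S) := by
  refine continuous_iff_continuousAt.2 fun x => ?_
  set e := chartAt (CSpace n) x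
  have hx : x ∈ e.source := mem_chart_source _ x
  have h1 := (contDiffAt_sqNorm H S (chart_mem_atlas _ x) (e.map_source hx)).continuousAt
  have h2 := h1.comp (e.continuousAt hx)
  refine h2.congr ?_
  filter_upwards [e.open_source.mem_nhds hx] with y hy
  change sqNorm H S (e.symm (e y)) = sqNorm H S y
  rw [e.left_inv hy]

/-- The curvature of `L` is bounded above by a multiple of `ω₀`:
`√-1 ∂∂̄ log |S|² ≥ -C ω₀` away from `D`. -/
lemma exists_curvature_bound [CompactSpace M] (ω₀ : KahlerForm n M) (H : HermitianMetric n L)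
    (S : Cₛ^ω⟮𝓘(ℂ, CSpace n); ℂ, L⟯) :
    ∃ C, 0 ≤ C ∧ ∀ x ∉ divisor S, ∃ e ∈ atlas (CSpace n) M, x ∈ e.source ∧
      ∀ w, 0 ≤ C * hermForm (coeff ω₀.form e (e x)) w
        + leviForm (fun y => Real.log (sqNorm H S (e.symm y))) (e x) w / 4 := by
  suffices h : ∃ C, 0 ≤ C ∧ ∀ x ∈ (Set.univ : Set M), x ∉ divisor S →
      ∃ e ∈ atlas (CSpace n) M, x ∈ e.source ∧
      ∀ w, 0 ≤ C * hermForm (coeff ω₀.form e (e x)) w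
        + leviForm (fun y => Real.log (sqNorm H S (e.symm y))) (e x) w / 4 by
    simpa using h
  -- Local constants are merged by taking maxima; the chart may vary with the point, since the bound
  -- is stated in some chart around each point.
  refine isCompact_univ.induction_on ⟨0, le_rfl, by simp⟩ ?_ ?_ ?_
  · rintro s t hst ⟨C, hC, h⟩
    exact ⟨C, hC, fun x hx => h x (hst hx)⟩
  · rintro s t ⟨C, hC, h⟩ ⟨C', hC', h'⟩
    have key : ∀ {B : ℝ}, B ≤ max C C' → ∀ {x : M} {e : OpenPartialHomeomorph M (CSpace n)},
        e ∈ atlas (CSpace n) M → x ∈ e.source → ∀ w : CSpace n,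
        B * hermForm (coeff ω₀.form e (e x)) w
          ≤ max C C' * hermForm (coeff ω₀.form e (e x)) w := fun hB x e he hx w =>
      mul_le_mul_of_nonneg_right hB
        (hermForm_nonneg (ω₀.posDef_coeff he (e.map_source hx)).posSemidef w)
    refine ⟨max C C', le_max_of_le_left hC, ?_⟩
    rintro x (hx | hx) hxD
    · obtain ⟨e, he, hxe, hw⟩ := h x hx hxD
      exact ⟨e, he, hxe, fun w => by
        linarith [hw w, key (le_max_left C C') he hxe w]⟩
    · obtain ⟨e, he, hxe, hw⟩ := h' x hx hxD
      exact ⟨e, he, hxe, fun w => by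
        linarith [hw w, key (le_max_right C C') he hxe w]⟩
  · intro x₀ _
    set e := chartAt (CSpace n) x₀
    have he : e ∈ atlas (CSpace n) M := chart_mem_atlas _ x₀
    have hx₀ : x₀ ∈ e.source := mem_chart_source _ x₀
    obtain ⟨U, hUe, hU, hzU, f, a, hf, ha, hapos, hfa⟩ :=
      exists_local_sqNorm H S he (e.map_source hx₀)
    obtain ⟨K, hKc, hxK, hK⟩ := exists_compact_subset hU hzU
    -- Off `D`, `log |S|² = 2 log |f| + log a` and the first term is pluriharmonic. Only `log a`
    -- contributes, and it is `C²` across `D`, so the constant does not degenerate near `D`.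
    have hla : ContDiffOn ℝ 2 (fun y => Real.log (a y)) U := ha.log fun y hy => (hapos y hy).ne'
    obtain ⟨C, hC, hCK⟩ := exists_leviForm_lower_bound hU hKc hK hla
      (G := fun z => coeff ω₀.form e z)
      (fun i j => (ω₀.smooth e he i j).continuousOn.mono hUe)
      (fun z hz w hw => ω₀.hermForm_coeff_pos he (hUe hz) hw)
    have hnhds : e.source ∩ e ⁻¹' K ∈ 𝓝 x₀ := Filter.inter_mem (e.open_source.mem_nhds hx₀)
      ((e.continuousAt hx₀).preimage_mem_nhds (mem_interior_iff_mem_nhds.1 hxK))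
    refine ⟨_, mem_nhdsWithin_of_mem_nhds hnhds, C, hC, fun x hx hxD => ⟨e, he, hx.1, fun w => ?_⟩⟩
    have hxU : e x ∈ U := hK hx.2
    have hfx : f (e x) ≠ 0 := by
      intro h0
      have := hfa (e x) hxU
      rw [h0, e.left_inv hx.1] at this
      exact hxD ((sqNorm_eq_zero_iff H S x).1 (by simpa using this))
    have hlog : (fun y => Real.log (sqNorm H S (e.symm y))) =ᶠ[𝓝 (e x)]
        fun y => 2 * Real.log ‖f y‖ + Real.log (a y) := by
      filter_upwards [hU.mem_nhds hxU, (hf _ hxU).continuousAt.eventually_ne hfx] with y hy hfy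
      rw [hfa y hy, Real.log_mul (pow_ne_zero _ (norm_ne_zero_iff.2 hfy)) (hapos y hy).ne',
        Real.log_pow]
      norm_num
    have hlf : ContDiffAt ℝ 2 (fun y => Real.log ‖f y‖) (e x) :=
      (((hf _ hxU).contDiffAt.restrict_scalars ℝ).norm ℝ hfx).log (by simpa using hfx)
    rw [leviForm_congr hlog, leviForm_add (contDiffAt_const.mul hlf)
      (hla.contDiffAt (hU.mem_nhds hxU)), leviForm_const_mul hlf, leviForm_log_norm (hf _ hxU) hfx]
    have := hCK (e x) hx.2 w
    linarith

end Section

/-! ### The maximum principle and uniqueness off the divisor. -/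

section Uniqueness

/-- A function that is maximal at the right end point of an interval has nonnegative derivative
there. -/
lemma deriv_nonneg_of_forall_le {g : ℝ → ℝ} {g' t : ℝ} (ht : 0 < t) (hg : HasDerivAt g g' t)
    (h : ∀ s ∈ Set.Icc 0 t, g s ≤ g t) : 0 ≤ g' := by
  have h1 := hg.hasDerivWithinAt (s := Set.Iio t)
  rw [hasDerivWithinAt_iff_tendsto_slope' (by simp)] at h1
  refine ge_of_tendsto h1 ?_
  filter_upwards [Ioo_mem_nhdsLT ht] with s hs
  rw [slope_def_field]
  exact div_nonneg_of_nonpos (by linarith [h s ⟨hs.1.le, hs.2.le⟩]) (by linarith [hs.2])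

variable {n : ℕ} {M : Type*} [TopologicalSpace M] [ChartedSpace (CSpace n) M]
  {L : M → Type*} [TopologicalSpace (Bundle.TotalSpace ℂ L)]
  [∀ x, AddCommGroup (L x)] [∀ x, Module ℂ (L x)] [∀ x, TopologicalSpace (L x)]
  [FiberBundle ℂ L]
  {ω₀ : KahlerForm n M} {H : HermitianMetric n L} {S : Cₛ^ω⟮𝓘(ℂ, CSpace n); ℂ, L⟯}
  {β δ α T : ℝ} {h φ₀ : M → ℝ}

/-- `ω_φ` is the sum of `ω_φ - C⁻¹ ω_D ≥ 0` and `C⁻¹ ω_D > 0`. -/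
lemma IsWeakConicalFlow.posDef_potMatrix {φ : ℝ → M → ℝ}
    (hφ : IsWeakConicalFlow ω₀ H S β δ α T h φ₀ φ) (hδpos : ModelPositive ω₀ H S β δ)
    {t : ℝ} (ht : t ∈ Set.Ioo 0 T) {e : OpenPartialHomeomorph M (CSpace n)}
    (he : e ∈ atlas (CSpace n) M) {z : CSpace n} (hz : z ∈ e.target) (hzD : e.symm z ∉ divisor S) :
    (ω₀.potMatrix (φ t) e z).PosDef := by
  obtain ⟨C, hC, hφC⟩ := hφ.quasiIsometric
  have h1 := (hφC t ht e he z hz hzD).1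
  have h2 := (hδpos e he z hz hzD).smul (inv_pos.2 hC)
  simpa using h2.add_posSemidef h1

variable [VectorBundle ℂ ℂ L] [CompactSpace M] [IsManifold 𝓘(ℂ, CSpace n) ω M]
  [ContMDiffVectorBundle ω ℂ L 𝓘(ℂ, CSpace n)]

/-- Comparison of two weak conical Kähler-Ricci flows with the same initial value, away from the
divisor: the maximum principle for `e^{-βt} (φ₁ - φ₂) + ε log |S|² - ε C₀ δ |S|^{2β} - ε K t`. -/
lemma IsWeakConicalFlow.le_of_notMem_divisor {φ₁ φ₂ : ℝ → M → ℝ}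
    (h₁ : IsWeakConicalFlow ω₀ H S β δ α T h φ₀ φ₁)
    (h₂ : IsWeakConicalFlow ω₀ H S β δ α T h φ₀ φ₂)
    (hδpos : ModelPositive ω₀ H S β δ) (hβ : 0 < β) (hδ : 0 < δ) (hα : 0 < α)
    {t : ℝ} (ht : t ∈ Set.Ioo 0 T) {x : M} (hx : x ∉ divisor S) : φ₁ t x ≤ φ₂ t x := by
  have := isManifold_real n M
  have : IsManifold 𝓘(ℝ, CSpace n) 2 M := IsManifold.of_le (n := ω) le_top
  obtain ⟨C₀, hC₀, hcurv⟩ := exists_curvature_bound ω₀ H S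
  obtain ⟨C₂, hC₂, hquasi⟩ := h₂.quasiIsometric
  set σ := sqNorm H S with hσ
  set m := modelPotential H S β δ with hm
  have hσc : Continuous σ := continuous_sqNorm H S
  have hσ0 : ∀ y, 0 ≤ σ y := sqNorm_nonneg H S
  have hσD : ∀ y, 0 < σ y ↔ y ∉ divisor S := fun y => by
    rw [← sqNorm_eq_zero_iff H S y, (hσ0 y).lt_iff_ne', Ne]
  have hmc : Continuous m := continuous_const.mul (hσc.rpow_const fun _ => Or.inr hβ.le)
  have hm0 : ∀ y, 0 ≤ m y := fun y => mul_nonneg hδ.le (Real.rpow_nonneg (hσ0 y) _)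
  obtain ⟨B, hB⟩ := (isCompact_univ.bddAbove_image hσc.continuousOn)
  have hσB : ∀ y, σ y ≤ max B 1 := fun y =>
    (hB (Set.mem_image_of_mem _ (Set.mem_univ y))).trans (le_max_left _ _)
  -- `n C₀ C₂` matches the error in the volume comparison; the extra `1` makes the final inequality
  -- strict.
  set K : ℝ := n * (C₀ * C₂) + 1 with hK
  have key : ∀ ε : ℝ, 0 < ε → Real.exp (-β * t) * (φ₁ t x - φ₂ t x) ≤
      ε * (Real.log (max B 1) - Real.log (σ x) + C₀ * m x + K * t) := by
    intro ε hε
    set E : ℝ × M → ℝ := fun p => Real.exp (-β * p.1) * φ₁ p.1 p.2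
      + -Real.exp (-β * p.1) * φ₂ p.1 p.2 + -(ε * C₀) * m p.2 - ε * K * p.1 with hE
    -- Stopping at `t < T` keeps the flow equation available even if the maximum occurs at the last
    -- time.
    set P : Set (ℝ × M) := Set.Icc 0 t ×ˢ Set.univ with hP
    have hPT : P ⊆ Set.Icc 0 T ×ˢ Set.univ :=
      Set.prod_mono (Set.Icc_subset_Icc_right ht.2.le) subset_rfl
    have hEc : ContinuousOn E P := by
      have c1 := (h₁.holder.continuousOn hα).mono hPT
      have c2 := (h₂.holder.continuousOn hα).mono hPT
      have c3 : ContinuousOn (fun p : ℝ × M => Real.exp (-β * p.1)) P := by fun_prop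
      have c4 : ContinuousOn (fun p : ℝ × M => m p.2) P := (hmc.comp continuous_snd).continuousOn
      have c5 : ContinuousOn (fun p : ℝ × M => ε * K * p.1) P := by fun_prop
      exact (((c3.mul c1).add (c3.neg.mul c2)).add (continuousOn_const.mul c4)).sub c5
    -- Exponentiating replaces `ε log σ + E`, which is singular on `D`, by a function that is
    -- continuous everywhere and vanishes on `D`.
    have hFc : ContinuousOn (fun p : ℝ × M => σ p.2 ^ ε * Real.exp (E p)) P :=
      ((hσc.comp continuous_snd).rpow_const fun _ => Or.inr hε.le).continuousOn.mul hEc.rexp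
    have hxP : (t, x) ∈ P := ⟨⟨ht.1.le, le_rfl⟩, trivial⟩
    obtain ⟨⟨t₀, x₀⟩, hp₀, hmax⟩ := (isCompact_Icc.prod isCompact_univ).exists_isMaxOn
      ⟨_, hxP⟩ hFc
    have hpos : ∀ p : ℝ × M, p.2 ∉ divisor S → 0 < σ p.2 ^ ε * Real.exp (E p) := fun p hp =>
      mul_pos (Real.rpow_pos_of_pos ((hσD _).2 hp) _) (Real.exp_pos _)
    have hx₀ : x₀ ∉ divisor S := by
      intro h0
      have h1 := (hpos (t, x) hx).trans_le (hmax hxP)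
      have h2 : σ x₀ = 0 := (sqNorm_eq_zero_iff H S x₀).2 h0
      simp [h2, Real.zero_rpow hε.ne'] at h1
    have hlog : ∀ p : ℝ × M, p.2 ∉ divisor S →
        Real.log (σ p.2 ^ ε * Real.exp (E p)) = ε * Real.log (σ p.2) + E p := fun p hp => by
      have := (hσD _).2 hp
      rw [Real.log_mul (Real.rpow_pos_of_pos this _).ne' (Real.exp_pos _).ne',
        Real.log_rpow this, Real.log_exp]
    have hle : ∀ s ∈ Set.Icc 0 t, ∀ y ∉ divisor S,
        ε * Real.log (σ y) + E (s, y) ≤ ε * Real.log (σ x₀) + E (t₀, x₀) := by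
      intro s hs y hy
      rw [← hlog (s, y) hy, ← hlog (t₀, x₀) hx₀]
      exact Real.log_le_log (hpos (s, y) hy) (hmax (show (s, y) ∈ P from ⟨hs, trivial⟩))
    have ht₀ : t₀ ∈ Set.Icc 0 t := hp₀.1
    rcases ht₀.1.eq_or_lt with h0 | h0
    -- At time `0` the two flows agree, so only the barrier terms remain.
    · have h1 := hle t ⟨ht.1.le, le_rfl⟩ x hx
      have h2 : Real.log (σ x₀) ≤ Real.log (max B 1) :=
        Real.log_le_log ((hσD _).2 hx₀) (hσB _)
      have h3 := mul_le_mul_of_nonneg_left h2 hε.le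
      have h4 : 0 ≤ ε * C₀ * m x₀ := mul_nonneg (mul_nonneg hε.le hC₀) (hm0 x₀)
      simp only [hE, ← h0, h₁.initial, h₂.initial, mul_zero] at h1
      linarith
    exfalso
    have ht₀T : t₀ ∈ Set.Ioo 0 T := ⟨h0, ht₀.2.trans_lt ht.2⟩
    obtain ⟨e, he, hxe, hcurv'⟩ := hcurv x₀ hx₀
    have hz : e x₀ ∈ e.target := e.map_source hxe
    have hzx : e.symm (e x₀) = x₀ := e.left_inv hxe
    have hzD : e.symm (e x₀) ∉ divisor S := by rwa [hzx]
    have hDopen : IsOpen (divisor S)ᶜ := by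
      have : (divisor S)ᶜ = {y | 0 < σ y} := Set.ext fun y => (hσD y).symm
      rw [this]
      exact isOpen_lt continuous_const hσc
    have hφ : ∀ {φ : ℝ → M → ℝ}, IsWeakConicalFlow ω₀ H S β δ α T h φ₀ φ →
        ContDiffAt ℝ 2 (φ t₀ ∘ e.symm) (e x₀) := fun hφ =>
      contDiffAt_comp_symm he hz ((hφ.contMDiffOn t₀ ht₀T).contMDiffAt (hDopen.mem_nhds hzD))
    have hσ2 := contDiffAt_sqNorm H S he hz
    have hσz : (sqNorm H S ∘ e.symm) (e x₀) ≠ 0 := ((hσD _).2 hzD).ne'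
    have hlogσ : ContDiffAt ℝ 2 (fun y => Real.log (sqNorm H S (e.symm y))) (e x₀) :=
      hσ2.log hσz
    have hm2 : ContDiffAt ℝ 2 (m ∘ e.symm) (e x₀) :=
      contDiffAt_const.mul (hσ2.rpow_const_of_ne hσz)
    have hspace := log_det_sub_le_of_isLocalMax (ω₀.posDef_coeff he hz) (hφ h₁) (hφ h₂) hlogσ hm2
      (h₁.posDef_potMatrix hδpos ht₀T he hz hzD) (h₂.posDef_potMatrix hδpos ht₀T he hz hzD)
      (Real.exp_pos (-β * t₀)) hε.le hC₀ hC₂.le hcurv' (fun w => by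
        have h3 := hermForm_nonneg (hquasi t₀ ht₀T e he _ hz hzD).1 w
        rw [hermForm_sub, hermForm_smul, sub_nonneg, inv_mul_le_iff₀ hC₂] at h3
        exact h3) (by
        have h4 : ∀ᶠ y in 𝓝 (e x₀), e.symm y ∉ divisor S :=
          (e.continuousAt_symm hz).preimage_mem_nhds (hDopen.mem_nhds hzD)
        filter_upwards [h4] with y hy
        have h5 := hle t₀ ht₀ _ hy
        simp only [hE] at h5
        simp only [Function.comp_apply, hzx]
        linarith)
    -- In the time derivative of `e^{-βt} (φ₁ - φ₂)` the zeroth order terms cancel and only the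
    -- difference of the log volume ratios survives. As `t₀` may equal `t`, only earlier times are
    -- compared, which still makes the derivative nonnegative; with `hspace` this gives `0 ≤ -ε`.
    have hd := ((h₁.flow t₀ ht₀T e he _ hz hzD).sub (h₂.flow t₀ ht₀T e he _ hz hzD))
    have hexp : HasDerivAt (fun s => Real.exp (-β * s)) (Real.exp (-β * t₀) * (-β * 1)) t₀ :=
      ((hasDerivAt_id t₀).const_mul (-β)).exp
    have hg := (hexp.mul hd).sub ((hasDerivAt_id t₀).const_mul (ε * K))
    have htime := deriv_nonneg_of_forall_le h0 hg fun s hs => by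
      have h5 := hle s ⟨hs.1, hs.2.trans ht₀.2⟩ x₀ hx₀
      simp only [hE] at h5
      simp only [Pi.sub_apply, Pi.mul_apply, hzx, id]
      linarith
    simp only [Pi.sub_apply, KahlerForm.volRatio, KahlerForm.potMatrix] at htime
    rw [hK] at htime
    nlinarith
  set A : ℝ := Real.log (max B 1) - Real.log (σ x) + C₀ * m x + K * t
  by_contra! hlt
  have hX : 0 < Real.exp (-β * t) * (φ₁ t x - φ₂ t x) :=
    mul_pos (Real.exp_pos _) (sub_pos.2 hlt)
  set X := Real.exp (-β * t) * (φ₁ t x - φ₂ t x)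
  -- With this `ε` the estimate reads `2 X (|A| + 1) ≤ X A`, impossible for `X > 0`.
  have h1 := key (X / (2 * (|A| + 1))) (by positivity)
  rw [div_mul_eq_mul_div, le_div_iff₀ (by positivity)] at h1
  have h2 : X * A ≤ X * |A| := mul_le_mul_of_nonneg_left (le_abs_self A) hX.le
  nlinarith [mul_nonneg hX.le (abs_nonneg A)]

/-- Weak conical Kähler-Ricci flows with the same initial value agree away from the divisor. -/
lemma IsWeakConicalFlow.eq_of_notMem_divisor {φ₁ φ₂ : ℝ → M → ℝ}
    (h₁ : IsWeakConicalFlow ω₀ H S β δ α T h φ₀ φ₁)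
    (h₂ : IsWeakConicalFlow ω₀ H S β δ α T h φ₀ φ₂)
    (hδpos : ModelPositive ω₀ H S β δ) (hβ : 0 < β) (hδ : 0 < δ) (hα : 0 < α)
    {t : ℝ} (ht : t ∈ Set.Ioo 0 T) {x : M} (hx : x ∉ divisor S) : φ₁ t x = φ₂ t x :=
  le_antisymm (h₁.le_of_notMem_divisor h₂ hδpos hβ hδ hα ht hx)
    (h₂.le_of_notMem_divisor h₁ hδpos hβ hδ hα ht hx)

end Uniqueness

end ConicalKRF

end

theorem mainTheorem7 {n : ℕ} {M : Type*} [TopologicalSpace M] [T2Space M] [CompactSpace M]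
    [ChartedSpace (ConicalKRF.CSpace n) M] [IsManifold 𝓘(ℂ, ConicalKRF.CSpace n) ω M]
    {L : M → Type*} [TopologicalSpace (Bundle.TotalSpace ℂ L)]
    [∀ x, AddCommGroup (L x)] [∀ x, Module ℂ (L x)] [∀ x, TopologicalSpace (L x)]
    [FiberBundle ℂ L] [VectorBundle ℂ ℂ L]
    [ContMDiffVectorBundle ω ℂ L 𝓘(ℂ, ConicalKRF.CSpace n)]
    (ω₀ : ConicalKRF.KahlerForm n M) (H : ConicalKRF.HermitianMetric n L)
    (S : Cₛ^ω⟮𝓘(ℂ, ConicalKRF.CSpace n); ℂ, L⟯) (hS : ConicalKRF.HasSmoothZeroDivisor S)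
    {β : ℝ} (hβ : β ∈ Set.Ioo (0 : ℝ) 1)
    {δ : ℝ} (hδ : 0 < δ) (hδpos : ConicalKRF.ModelPositive ω₀ H S β δ)
    {α : ℝ} (hα : α ∈ Set.Ioo (0 : ℝ) 1) {T : ℝ} (hT : 0 < T)
    {h : M → ℝ} (hh : ContMDiff 𝓘(ℝ, ConicalKRF.CSpace n) 𝓘(ℝ, ℝ) ∞ h)
    {φ₀ : M → ℝ} {φ₁ φ₂ : ℝ → M → ℝ}
    (h₁ : ConicalKRF.IsWeakConicalFlow ω₀ H S β δ α T h φ₀ φ₁)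
    (h₂ : ConicalKRF.IsWeakConicalFlow ω₀ H S β δ α T h φ₀ φ₂) :
    ∀ t ∈ Set.Icc 0 T, ∀ x : M, φ₁ t x = φ₂ t x := by
  have hcont := (h₁.holder.continuousOn hα.1).sub (h₂.holder.continuousOn hα.1)
  intro t ht x
  -- Transversality makes the complement of `D` dense, so the difference, continuous on `[0,T] × M`,
  -- vanishes on a dense subset.
  have hmem : (t, x) ∈ closure (Set.Ioo 0 T ×ˢ (ConicalKRF.divisor S)ᶜ) := by
    rw [closure_prod_eq, closure_Ioo hT.ne, hS.dense_compl.closure_eq]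
    exact ⟨ht, trivial⟩
  have hsub : Set.Ioo 0 T ×ˢ (ConicalKRF.divisor S)ᶜ ⊆ (Set.Icc 0 T ×ˢ Set.univ : Set (ℝ × M)) :=
    Set.prod_mono Set.Ioo_subset_Icc_self (Set.subset_univ _)
  have hzero := ((hcont (t, x) ⟨ht, trivial⟩).mono hsub).mem_closure hmem (t := {0}) (by
    rintro ⟨s, y⟩ hs
    exact sub_eq_zero.2 (h₁.eq_of_notMem_divisor h₂ hδpos hβ.1 hδ hα.1 hs.1 hs.2))
  rw [closure_singleton] at hzero
  exact sub_eq_zero.1 hzero
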